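/- Let $T$ be a first-order theory. For a model $M$ of $T$, an interpretable set in $M$ is a definable subset of a quotient $M^n/E$, where $E$ is a definable equivalence relation on $M^n$ (definable always means definable with parameters); a map or operation between interpretable sets is interpretable if its graph is definable. The theory $T$ is called finite-dimensional if there is a function $\dim$ assigning to every interpretable set in every model of $T$ a value in $\omega\cup\{-\infty\}$ such that, for all formulas $\phi(x,y)$, interpretable sets $X,Y$ and interpretable functions $f:X\to Y$: - (Invariance) if $a$ and $a'$ are tuples (in models of $T$) with the same type over $\emptyset$, then $\dim\phi(x,a)=\dim\phi(x,a')$; - (Algebraicity) $\dim\emptyset=-\infty$, and $\dim X=0$ if and only if $X$ is finite and non-empty; - (Union) if $X$ and $Y$ are subsets of the same quotient $M^n/E$, then $\dim(X\cup Y)=\max\{\dim X,\dim Y\}$; - (Upper fibration) for $k\in\omega$, if $\dim f^{-1}(y)\ge k$ for every $y\in Y$, then $\dim X\ge\dim Y+k$; - (Lower fibration) for $k\in\omega$, if $\dim f^{-1}(y)\le k$ for every $y\in Y$, then $\dim X\le\dim Y+k$. Lemma. Let $T$ be a finite-dimensional theory, let $M$ be a model of $T$, and let $K$ be a field interpretable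 in $M$ (in particular, any field definable in $M$); that is, the underlying set of $K$ is an interpretable set in $M$, and the addition and multiplication of $K$ are interpretable. Let $\delta:K\to K$ be a derivation, i.e. an additive map with $\delta(kk')=k\,\delta(k')+k'\,\delta(k)$ for all $k,k'\in K$, and suppose that the graph of $\delta$ is definable in $M$. Then $\delta=0$. -/

import Mathlib

universe u v w

/-- An imaginary sort of the structure `M`: a quotient of a Cartesian power `M ^ n` by an
equivalence relation that is definable in `M` (with parameters). -/
structure ImaginarySort (L : FirstOrder.Language.{u, v}) (M : Type w) [L.Structure M] (n : ℕ) where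
  /-- The equivalence relation on `M ^ n`. -/
  rel : Setoid (Fin n → M)
  definable_rel : (Set.univ : Set M).Definable L
    {v : Fin n ⊕ Fin n → M | rel (v ∘ Sum.inl) (v ∘ Sum.inr)}

namespace ImaginarySort

variable {L : FirstOrder.Language.{u, v}} {M : Type w} [L.Structure M] {n n₁ n₂ n₃ : ℕ}

/-- The elements of the imaginary sort, i.e. the set `M ^ n / E`. -/
def Elem (S : ImaginarySort L M n) : Type w := Quotient S.rel

/-- The class of a tuple. -/
def cls (S : ImaginarySort L M n) (x : Fin n → M) : S.Elem := Quotient.mk S.rel x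

/-- `X` is an interpretable set: a subset of `M ^ n / E` whose preimage in `M ^ n` is definable
(with parameters). Every quotient of a definable set `X ⊆ M ^ n` by a definable equivalence
relation on `X` is of this form (extend the relation by equality outside `X`), and the definable
subsets of `M ^ n` are the case in which `E` is equality. -/
def IsInterpretable (S : ImaginarySort L M n) (X : Set S.Elem) : Prop :=
  (Set.univ : Set M).Definable L {v : Fin n → M | S.cls v ∈ X}

/-- A binary relation between two imaginary sorts is definable (with parameters). -/
def IsInterpretable₂ (S₁ : ImaginarySort L M n₁) (S₂ : ImaginarySort L M n₂)
    (R : S₁.Elem → S₂.Elem → Prop) : Prop :=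
  (Set.univ : Set M).Definable L
    {v : Fin n₁ ⊕ Fin n₂ → M | R (S₁.cls (v ∘ Sum.inl)) (S₂.cls (v ∘ Sum.inr))}

/-- A ternary relation between imaginary sorts is definable (with parameters). -/
def IsInterpretable₃ (S₁ : ImaginarySort L M n₁) (S₂ : ImaginarySort L M n₂)
    (S₃ : ImaginarySort L M n₃) (R : S₁.Elem → S₂.Elem → S₃.Elem → Prop) : Prop :=
  (Set.univ : Set M).Definable L
    {v : Fin n₁ ⊕ Fin n₂ ⊕ Fin n₃ → M |
      R (S₁.cls (v ∘ Sum.inl)) (S₂.cls (v ∘ Sum.inr ∘ Sum.inl)) (S₃.cls (v ∘ Sum.inr ∘ Sum.inr))}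

/-- A function `f : X → Y` between subsets of imaginary sorts is interpretable: its graph is
definable (with parameters). -/
def IsInterpretableMap (S₁ : ImaginarySort L M n₁) (S₂ : ImaginarySort L M n₂)
    {X : Set S₁.Elem} {Y : Set S₂.Elem} (f : X → Y) : Prop :=
  IsInterpretable₂ S₁ S₂ fun a b => ∃ x : X, (x : S₁.Elem) = a ∧ (f x : S₂.Elem) = b

/-- A binary operation on a subset of an imaginary sort is interpretable: its graph is definable
(with parameters). -/
def IsInterpretableOp (S : ImaginarySort L M n) {X : Set S.Elem} (op : X → X → X) : Prop :=
  IsInterpretable₃ S S S fun a b c =>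
    ∃ x y : X, (x : S.Elem) = a ∧ (y : S.Elem) = b ∧ (op x y : S.Elem) = c

end ImaginarySort

/-- A dimension function for the theory `T`: it assigns to every interpretable set in every model
of `T` (of a given universe) an element of `ω ∪ {-∞}`, here `WithBot ℕ` with `⊥ = -∞`. The values
of `dim` on sets that are not interpretable play no role. -/
structure DimensionFunction {L : FirstOrder.Language.{u, v}} (T : L.Theory) where
  /-- The dimension of the subset `X` of the imaginary sort `S` of the model `M`. -/
  dim : (M : FirstOrder.Language.Theory.ModelType.{u, v, w} T) → {n : ℕ} → (S : ImaginarySort L M n) →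
    Set S.Elem → WithBot ℕ
  /-- Invariance: if `a` and `a'` have the same type over the empty set, then the interpretable
  sets defined by the same formulas over `a` and over `a'` have the same dimension. Here `ε`
  defines the equivalence relation and `φ` the subset of the quotient. -/
  invariance : ∀ (M N : FirstOrder.Language.Theory.ModelType.{u, v, w} T) {n k : ℕ}
    (ε : L.Formula ((Fin n ⊕ Fin n) ⊕ Fin k)) (φ : L.Formula (Fin n ⊕ Fin k))
    (a : Fin k → M) (a' : Fin k → N)
    (S : ImaginarySort L M n) (S' : ImaginarySort L N n) (X : Set S.Elem) (X' : Set S'.Elem),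
    T.typeOf a = T.typeOf a' →
    (∀ x y, S.rel x y ↔ ε.Realize (Sum.elim (Sum.elim x y) a)) →
    (∀ x y, S'.rel x y ↔ ε.Realize (Sum.elim (Sum.elim x y) a')) →
    (∀ x, S.cls x ∈ X ↔ φ.Realize (Sum.elim x a)) →
    (∀ x, S'.cls x ∈ X' ↔ φ.Realize (Sum.elim x a')) →
    dim M S X = dim N S' X'
  dim_empty : ∀ (M : FirstOrder.Language.Theory.ModelType.{u, v, w} T) {n : ℕ} (S : ImaginarySort L M n),
    dim M S ∅ = ⊥
  /-- Algebraicity; the empty set, of dimension `-∞`, is not counted among the finite sets. -/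
  dim_eq_zero_iff : ∀ (M : FirstOrder.Language.Theory.ModelType.{u, v, w} T) {n : ℕ} (S : ImaginarySort L M n)
    (X : Set S.Elem), S.IsInterpretable X → (dim M S X = 0 ↔ X.Nonempty ∧ X.Finite)
  dim_union : ∀ (M : FirstOrder.Language.Theory.ModelType.{u, v, w} T) {n : ℕ} (S : ImaginarySort L M n)
    (X Y : Set S.Elem), S.IsInterpretable X → S.IsInterpretable Y →
    dim M S (X ∪ Y) = max (dim M S X) (dim M S Y)
  upper_fibration : ∀ (M : FirstOrder.Language.Theory.ModelType.{u, v, w} T) {n m : ℕ}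
    (S : ImaginarySort L M n) (S' : ImaginarySort L M m) (X : Set S.Elem) (Y : Set S'.Elem)
    (f : X → Y) (k : ℕ), S.IsInterpretable X → S'.IsInterpretable Y →
    S.IsInterpretableMap S' f →
    (∀ y : Y, (k : WithBot ℕ) ≤ dim M S (Subtype.val '' (f ⁻¹' {y}))) →
    dim M S' Y + k ≤ dim M S X
  lower_fibration : ∀ (M : FirstOrder.Language.Theory.ModelType.{u, v, w} T) {n m : ℕ}
    (S : ImaginarySort L M n) (S' : ImaginarySort L M m) (X : Set S.Elem) (Y : Set S'.Elem)
    (f : X → Y) (k : ℕ), S.IsInterpretable X → S'.IsInterpretable Y →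
    S.IsInterpretableMap S' f →
    (∀ y : Y, dim M S (Subtype.val '' (f ⁻¹' {y})) ≤ (k : WithBot ℕ)) →
    dim M S X ≤ dim M S' Y + k

/-- A theory is finite-dimensional if it admits a dimension function. -/
def FiniteDimensionalTheory {L : FirstOrder.Language.{u, v}} (T : L.Theory) : Prop :=
  Nonempty (DimensionFunction.{u, v, w} T)

/-! The constants `C` of `δ` form a definable subfield of `K`. If `V` is a definable `C`-subspace
and `a ∉ V`, the coefficient of `a` fibres `V ⊕ Ca` over `C` with fibres the translates of `V`, so
upper fibration gives `dim (V ⊕ Ca) ≥ dim C + dim V` (`dimIn_add_le_sup_span`).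

In characteristic zero `C` is infinite, so `dim C ≥ 1`. Were `K` infinite-dimensional over `C`,
adjoining vectors one at a time would make dimensions unbounded, against `dim K ∈ ω`. So `K` is
algebraic and separable over `C`, and `δ` vanishes.

In characteristic `p`, `C` contains all `p`-th powers, and injectivity of Frobenius gives `dim K ≤
dim C`. An element outside `C` would force `2 dim K ≤ dim K`, hence `K` finite; but a finite field
consists of `p`-th powers. -/

namespace ImaginarySort

/-! ### Calculus of definable predicates and functions on an interpretable set -/

open FirstOrder Set

variable {L : FirstOrder.Language.{u, v}} {M : Type w} [L.Structure M] {n : ℕ}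
  {S : ImaginarySort L M n} {K : Set S.Elem} {ι κ : Type}

theorem definable_of_mem_iff {α : Type*} {s t : Set (α → M)} (hs : (univ : Set M).Definable L s)
    (h : ∀ v, v ∈ s ↔ v ∈ t) : (univ : Set M).Definable L t :=
  Set.ext h ▸ hs

/-- The class of the block with index `i` of a tuple of tuples. -/
def blockCls (S : ImaginarySort L M n) (v : ι × Fin n → M) (i : ι) : S.Elem :=
  S.cls fun j => v (i, j)

/-- A relation on a subset `K` of an imaginary sort is definable (with parameters). -/
def DefPred (P : (ι → K) → Prop) : Prop :=
  (univ : Set M).Definable L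
    {v : ι × Fin n → M | ∃ w : ι → K, (∀ i, (w i : S.Elem) = S.blockCls v i) ∧ P w}

theorem exists_blockCls (w : ι → S.Elem) : ∃ v : ι × Fin n → M, ∀ i, w i = S.blockCls v i := by
  choose r hr using fun i => Quotient.exists_rep (w i)
  exact ⟨fun p => r p.1 p.2, fun i => (hr i).symm⟩

theorem eq_of_blockCls {w w' : ι → K} {v : ι × Fin n → M}
    (h : ∀ i, (w i : S.Elem) = S.blockCls v i) (h' : ∀ i, (w' i : S.Elem) = S.blockCls v i) :
    w = w' :=
  funext fun i => Subtype.ext ((h i).trans (h' i).symm)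

theorem DefPred.congr {P Q : (ι → K) → Prop} (h : DefPred P) (hPQ : ∀ w, P w ↔ Q w) :
    DefPred Q := by
  rwa [← funext fun w => propext (hPQ w)]

theorem DefPred.true [Finite ι] (hK : S.IsInterpretable K) :
    DefPred fun _ : ι → K => True := by
  have h : ∀ i : ι, (univ : Set M).Definable L
      {v : ι × Fin n → M | S.blockCls v i ∈ K} := fun i =>
    Definable.preimage_comp (fun j => (i, j)) hK
  refine definable_of_mem_iff (definable_iInter_of_finite h) fun v => ?_
  simp only [mem_iInter, mem_ofPred, and_true]
  exact ⟨fun h => ⟨fun i => ⟨_, h i⟩, fun _ => rfl⟩, fun ⟨w, hw⟩ i => hw i ▸ (w i).2⟩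

theorem DefPred.and {P Q : (ι → K) → Prop} (hP : DefPred P) (hQ : DefPred Q) :
    DefPred fun w => P w ∧ Q w := by
  refine definable_of_mem_iff (hP.inter hQ) fun v => ?_
  constructor
  · rintro ⟨⟨w, hw, h⟩, ⟨w', hw', h'⟩⟩
    obtain rfl := eq_of_blockCls hw hw'
    exact ⟨w, hw, h, h'⟩
  · rintro ⟨w, hw, h, h'⟩
    exact ⟨⟨w, hw, h⟩, ⟨w, hw, h'⟩⟩

theorem DefPred.reindex [Finite ι] (hK : S.IsInterpretable K) {P : (κ → K) → Prop}
    (hP : DefPred P) (g : κ → ι) : DefPred fun w : ι → K => P (w ∘ g) := by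
  refine definable_of_mem_iff ((DefPred.true (ι := ι) hK).inter
    (Definable.preimage_comp (Prod.map g id) hP)) fun v => ?_
  constructor
  · rintro ⟨⟨w, hw, -⟩, ⟨w', hw', h'⟩⟩
    obtain rfl : w' = w ∘ g := funext fun i => Subtype.ext ((hw' i).trans (hw (g i)).symm)
    exact ⟨w, hw, h'⟩
  · rintro ⟨w, hw, h⟩
    exact ⟨⟨w, hw, trivial⟩, ⟨w ∘ g, fun i => hw (g i), h⟩⟩

theorem DefPred.exists_tuple [Finite κ] {P : (ι ⊕ κ → K) → Prop} (hP : DefPred P) :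
    DefPred fun v : ι → K => ∃ w : κ → K, P (Sum.elim v w) := by
  have h := Definable.exists_of_finite (Definable.preimage_comp
    (fun p : (ι ⊕ κ) × Fin n => p.1.elim (fun i => Sum.inl (i, p.2)) fun k => Sum.inr (k, p.2)) hP)
  refine definable_of_mem_iff h fun v => ?_
  constructor
  · rintro ⟨u, w, hw, h⟩
    refine ⟨w ∘ Sum.inl, fun i => hw (Sum.inl i), w ∘ Sum.inr, ?_⟩
    rwa [Sum.elim_comp_inl_inr]
  · rintro ⟨w, hw, w', h⟩
    obtain ⟨u, hu⟩ := exists_blockCls (S := S) fun k => (w' k : S.Elem)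
    refine ⟨u, Sum.elim w w', ?_, h⟩
    rintro (i | k)
    · exact hw i
    · exact hu k

theorem DefPred.forall_finite [Finite ι] [Finite κ] (hK : S.IsInterpretable K)
    {P : κ → (ι → K) → Prop}
    (hP : ∀ k, DefPred (P k)) : DefPred fun w => ∀ k, P k w := by
  refine definable_of_mem_iff ((DefPred.true (ι := ι) hK).inter (definable_iInter_of_finite hP)) fun v => ?_
  simp only [mem_inter_iff, mem_iInter, mem_ofPred, and_true]
  constructor
  · rintro ⟨⟨w, hw⟩, h⟩
    refine ⟨w, hw, fun k => ?_⟩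
    obtain ⟨w', hw', h'⟩ := h k
    rwa [eq_of_blockCls hw hw']
  · rintro ⟨w, hw, h⟩
    exact ⟨⟨w, hw⟩, fun k => ⟨w, hw, h k⟩⟩

/-- A function between powers of a subset `K` of an imaginary sort is definable. -/
def DefFun (f : (ι → K) → K) : Prop :=
  DefPred fun w : ι ⊕ Unit → K => f (w ∘ Sum.inl) = w (Sum.inr ())

/-- Name the values of the terms by an existential quantifier: `P (f v)` holds iff some `w`
satisfies `f v = w` and `P w`. This lets definability be checked term by term. -/
theorem DefPred.subst [Finite ι] [Finite κ] (hK : S.IsInterpretable K) {P : (κ → K) → Prop}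
    (hP : DefPred P) {f : κ → (ι → K) → K} (hf : ∀ k, DefFun (f k)) :
    DefPred fun v => P fun k => f k v := by
  have h1 : DefPred fun w : ι ⊕ κ → K => ∀ k, f k (w ∘ Sum.inl) = w (Sum.inr k) :=
    DefPred.forall_finite hK fun k =>
      (hf k).reindex hK (Sum.elim Sum.inl fun _ => Sum.inr k)
  refine (h1.and (hP.reindex hK Sum.inr)).exists_tuple.congr fun v => ?_
  constructor
  · rintro ⟨w, hw, h⟩
    obtain rfl : (fun k => f k v) = w := funext hw
    exact h
  · exact fun h => ⟨fun k => f k v, fun k => rfl, h⟩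

/-- On representatives, equality of classes is the definable equivalence relation of the sort. -/
theorem defPred_eq (hK : S.IsInterpretable K) :
    DefPred fun w : Unit ⊕ Unit → K => w (Sum.inl ()) = w (Sum.inr ()) := by
  refine definable_of_mem_iff ((DefPred.true (ι := Unit ⊕ Unit) hK).inter (Definable.preimage_comp
    (Sum.elim (fun j => (Sum.inl (), j)) fun j => (Sum.inr (), j)) S.definable_rel)) fun v => ?_
  have key : S.blockCls v (Sum.inl ()) = S.blockCls v (Sum.inr ()) ↔
      S.rel (fun j => v (Sum.inl (), j)) (fun j => v (Sum.inr (), j)) := Quotient.eq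
  constructor
  · rintro ⟨⟨w, hw, -⟩, h⟩
    exact ⟨w, hw, Subtype.ext (by rw [hw, hw]; exact key.2 h)⟩
  · rintro ⟨w, hw, h⟩
    exact ⟨⟨w, hw, trivial⟩, key.1 (by rw [← hw, ← hw, h])⟩

theorem defFun_proj [Finite ι] (hK : S.IsInterpretable K) (i : ι) :
    DefFun fun w : ι → K => w i :=
  (defPred_eq hK).reindex hK (Sum.elim (fun _ => Sum.inl i) fun _ => Sum.inr ())

theorem DefFun.comp [Finite ι] [Finite κ] (hK : S.IsInterpretable K) {g : (κ → K) → K}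
    (hg : DefFun g) {f : κ → (ι → K) → K} (hf : ∀ k, DefFun (f k)) :
    DefFun fun v => g fun k => f k v := by
  refine DefPred.subst hK hg (f := fun k w => Sum.elim (fun k => f k (w ∘ Sum.inl))
    (fun _ => w (Sum.inr ())) k) ?_
  rintro (k | _)
  · exact (hf k).reindex hK (Sum.map Sum.inl id)
  · exact defFun_proj hK _

theorem DefPred.eq [Finite ι] (hK : S.IsInterpretable K) {f g : (ι → K) → K} (hf : DefFun f)
    (hg : DefFun g) : DefPred fun v => f v = g v :=
  (defPred_eq hK).subst hK (f := Sum.elim (fun _ => f) fun _ => g)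
    (by rintro (_ | _) <;> assumption)

theorem definable_singleton (m : Fin n → M) : (univ : Set M).Definable L {m} := by
  refine definable_of_mem_iff (definable_iInter_of_finite fun j : Fin n =>
    Definable.preimage_comp (fun _ : Fin 1 => j)
      (Definable.singleton_of_mem (L := L) (mem_univ (m j)))) fun v => ?_
  simp [funext_iff]

theorem defFun_const [Finite ι] (hK : S.IsInterpretable K) (a : K) :
    DefFun fun _ : ι → K => a := by
  have h : DefPred fun w : Unit → K => a = w () := by
    obtain ⟨m, hm⟩ := Quotient.exists_rep (a : S.Elem)
    -- The coordinates of the representative `m` of `a` serve as parameters.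
    have h0 : (univ : Set M).Definable L {v : Fin n → M | S.rel m v} := by
      refine definable_of_mem_iff (Definable.exists_of_finite
        ((S.definable_rel.preimage_comp Sum.swap).inter
          ((definable_singleton m).preimage_comp Sum.inr))) fun v => ?_
      constructor
      · rintro ⟨u, h1, rfl⟩
        exact h1
      · exact fun h => ⟨m, h, rfl⟩
    refine definable_of_mem_iff
      ((DefPred.true (ι := Unit) hK).inter (h0.preimage_comp fun j => ((), j))) fun v => ?_
    have key : (a : S.Elem) = S.blockCls v () ↔ S.rel m (fun j => v ((), j)) := by
      rw [← hm]; exact Quotient.eq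
    constructor
    · rintro ⟨⟨w, hw, -⟩, h⟩
      exact ⟨w, hw, Subtype.ext (by rw [hw]; exact key.2 h)⟩
    · rintro ⟨w, hw, h⟩
      exact ⟨⟨w, hw, trivial⟩, key.1 (by rw [← hw, h])⟩
  exact h.reindex hK Sum.inr

theorem DefPred.ex {P : (ι → K) → K → Prop}
    (h : DefPred fun w : ι ⊕ Unit → K => P (w ∘ Sum.inl) (w (Sum.inr ()))) :
    DefPred fun v => ∃ x, P v x :=
  h.exists_tuple.congr fun _ => ⟨fun ⟨w, hw⟩ => ⟨w (), hw⟩, fun ⟨x, hx⟩ => ⟨fun _ => x, hx⟩⟩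

/-- A subset of `K` is definable. -/
def DefSet (A : Set K) : Prop := DefPred fun w : Unit → K => w () ∈ A

theorem DefSet.mem [Finite ι] (hK : S.IsInterpretable K) {A : Set K} (hA : DefSet A)
    {f : (ι → K) → K} (hf : DefFun f) : DefPred fun v => f v ∈ A :=
  hA.subst hK (f := fun _ => f) fun _ => hf

theorem DefSet.isInterpretable {A : Set K} (hA : DefSet A) :
    S.IsInterpretable (Subtype.val '' A) := by
  refine definable_of_mem_iff (hA.preimage_comp Prod.snd) fun v => ?_
  constructor
  · rintro ⟨w, hw, h⟩
    exact ⟨w (), h, hw ()⟩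
  · rintro ⟨x, h, hx⟩
    exact ⟨fun _ => x, fun _ => hx, h⟩

theorem defFun_of_isInterpretableMap {f : K → K} (hf : S.IsInterpretableMap S f) :
    DefFun fun w : Unit → K => f (w ()) := by
  refine definable_of_mem_iff (hf.preimage_comp
    (Sum.elim (fun j => (Sum.inl (), j)) fun j => (Sum.inr (), j))) fun v => ?_
  constructor
  · rintro ⟨x, hx, hy⟩
    exact ⟨Sum.elim (fun _ => x) fun _ => f x, by rintro (_ | _) <;> assumption, rfl⟩
  · rintro ⟨w, hw, h⟩
    exact ⟨w (Sum.inl ()), hw _, (congrArg _ h).trans (hw _)⟩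

theorem defFun_of_isInterpretableOp {op : K → K → K} (h : S.IsInterpretableOp op) :
    DefFun fun w : Unit ⊕ Unit → K => op (w (Sum.inl ())) (w (Sum.inr ())) := by
  refine definable_of_mem_iff (h.preimage_comp
    (Sum.elim (fun j => (Sum.inl (Sum.inl ()), j))
      (Sum.elim (fun j => (Sum.inl (Sum.inr ()), j)) fun j => (Sum.inr (), j)))) fun v => ?_
  constructor
  · rintro ⟨x, y, hx, hy, hz⟩
    exact ⟨Sum.elim (Sum.elim (fun _ => x) fun _ => y) fun _ => op x y,
      by rintro ((_ | _) | _) <;> assumption, rfl⟩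
  · rintro ⟨w, hw, h⟩
    exact ⟨w (Sum.inl (Sum.inl ())), w (Sum.inl (Sum.inr ())), hw _, hw _,
      (congrArg _ h).trans (hw _)⟩

theorem DefFun.map [Finite ι] (hK : S.IsInterpretable K) {f : K → K}
    (hf : S.IsInterpretableMap S f) {g : (ι → K) → K} (hg : DefFun g) :
    DefFun fun v => f (g v) :=
  (defFun_of_isInterpretableMap hf).comp hK (f := fun _ => g) fun _ => hg

theorem DefFun.op [Finite ι] (hK : S.IsInterpretable K) {op : K → K → K}
    (hop : S.IsInterpretableOp op) {f g : (ι → K) → K} (hf : DefFun f) (hg : DefFun g) :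
    DefFun fun v => op (f v) (g v) :=
  (defFun_of_isInterpretableOp hop).comp hK (f := Sum.elim (fun _ => f) fun _ => g)
    (by rintro (_ | _) <;> assumption)

end ImaginarySort

/-! ### Dimension inequalities from the axioms -/

namespace DimensionFunction

open FirstOrder ImaginarySort Set

variable {L : FirstOrder.Language.{u, v}} {T : L.Theory} (D : DimensionFunction.{u, v, w} T)
  {M : FirstOrder.Language.Theory.ModelType.{u, v, w} T} {n : ℕ} {S : ImaginarySort L M n}
  {K : Set S.Elem}

/-- The dimension of a subset of the interpretable set `K`. -/
def dimIn (A : Set K) : WithBot ℕ := D.dim M S (Subtype.val '' A)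

theorem dimIn_mono {A B : Set K} (hA : DefSet A) (hB : DefSet B) (h : A ⊆ B) :
    D.dimIn A ≤ D.dimIn B := by
  have h1 := D.dim_union M S _ _ hA.isInterpretable hB.isInterpretable
  rw [union_eq_self_of_subset_left (image_mono h)] at h1
  exact (le_max_left _ _).trans h1.ge

theorem dimIn_singleton (hK : S.IsInterpretable K) (a : K) : D.dimIn {a} = 0 := by
  have h : DefSet {a} := DefPred.eq hK (defFun_proj hK ()) (defFun_const hK a)
  exact (D.dim_eq_zero_iff M S _ h.isInterpretable).2 ⟨by simp, by simp⟩

theorem dimIn_nonneg (hK : S.IsInterpretable K) {A : Set K} (hA : DefSet A) (h : A.Nonempty) :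
    0 ≤ D.dimIn A := by
  obtain ⟨a, ha⟩ := h
  rw [← D.dimIn_singleton hK a]
  exact D.dimIn_mono (DefPred.eq hK (defFun_proj hK ()) (defFun_const hK a)) hA (by simpa using ha)

theorem one_le_dimIn (hK : S.IsInterpretable K) {A : Set K} (hA : DefSet A) (h : A.Infinite) :
    1 ≤ D.dimIn A := by
  have h0 := D.dimIn_nonneg hK hA h.nonempty
  have h1 : D.dimIn A ≠ 0 := fun h1 =>
    h ((D.dim_eq_zero_iff M S _ hA.isInterpretable).1 h1 |>.2.of_finite_image
      Subtype.val_injective.injOn)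
  revert h0 h1
  generalize D.dimIn A = d
  cases d with
  | bot => simp
  | coe d => exact fun _ h =>
      WithBot.coe_le_coe.2 (Nat.one_le_iff_ne_zero.2 fun hd => h (congrArg _ hd))

/-- Upper fibration for a map given by its graph `R`, so that definability need only be checked for
a formula and no map between subtypes has to be built in applications. -/
theorem dimIn_add_le {A B : Set K} (hA : DefSet A) (hB : DefSet B) {R : K → K → Prop}
    (hR : DefPred fun w : Unit ⊕ Unit → K => R (w (Sum.inl ())) (w (Sum.inr ())))
    (hRA : ∀ x y, R x y → x ∈ A) (hRB : ∀ x y, R x y → y ∈ B)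
    (huniq : ∀ x y y', R x y → R x y' → y = y') (htot : ∀ x ∈ A, ∃ y, R x y) (k : ℕ)
    (hk : ∀ y ∈ B, (k : WithBot ℕ) ≤ D.dimIn {x | R x y}) : D.dimIn B + k ≤ D.dimIn A := by
  have htot' : ∀ x : (Subtype.val '' A : Set S.Elem), ∃ y : (Subtype.val '' B : Set S.Elem),
      ∃ x' y' : K, (x' : S.Elem) = x ∧ (y' : S.Elem) = y ∧ R x' y' := by
    rintro ⟨_, x, hx, rfl⟩
    obtain ⟨y, hy⟩ := htot x hx
    exact ⟨⟨y, y, hRB x y hy, rfl⟩, x, y, rfl, rfl, hy⟩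
  choose f hf using htot'
  have hfR : ∀ (x : (Subtype.val '' A : Set S.Elem)) (y : (Subtype.val '' B : Set S.Elem)) (x' y' : K),
      (x' : S.Elem) = x → (y' : S.Elem) = y → (f x = y ↔ R x' y') := by
    rintro x y x' y' hx hy
    obtain ⟨a, b, ha, hb, hab⟩ := hf x
    obtain rfl : a = x' := Subtype.ext (ha.trans hx.symm)
    rw [Subtype.ext_iff, ← hb, ← hy, ← Subtype.ext_iff]
    exact ⟨fun h => h ▸ hab, huniq _ _ _ hab⟩
  refine D.upper_fibration M S S _ _ f k hA.isInterpretable hB.isInterpretable ?_ ?_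
  · refine definable_of_mem_iff (hR.preimage_comp
      fun p => p.1.elim (fun _ => Sum.inl p.2) fun _ => Sum.inr p.2) fun v => ?_
    constructor
    · rintro ⟨w, hw, h⟩
      refine ⟨⟨w (Sum.inl ()), _, hRA _ _ h, rfl⟩, hw _, ?_⟩
      rw [(hfR _ ⟨w (Sum.inr ()), _, hRB _ _ h, rfl⟩ _ _ rfl rfl).2 h]
      exact hw _
    · rintro ⟨x, hx, hy⟩
      obtain ⟨a, b, ha, hb, hab⟩ := hf x
      refine ⟨Sum.elim (fun _ => a) fun _ => b, ?_, hab⟩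
      rintro (_ | _)
      · exact ha.trans hx
      · exact hb.trans hy
  · rintro ⟨_, y, hy, rfl⟩
    refine (hk y hy).trans_eq (congrArg (D.dim M S) ?_)
    ext z
    constructor
    · rintro ⟨x, h, rfl⟩
      exact ⟨⟨x, x, hRA _ _ h, rfl⟩, (hfR _ _ _ _ rfl rfl).2 h, rfl⟩
    · rintro ⟨x, h, rfl⟩
      obtain ⟨x, a, ha, rfl⟩ := x
      exact ⟨a, (hfR _ _ _ _ rfl rfl).1 h, rfl⟩

/-- Nonempty fibres have dimension at least `0`, so upper fibration applies with `k = 0`. -/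
theorem dimIn_le_of_surjOn (hK : S.IsInterpretable K) {A B : Set K} (hA : DefSet A)
    (hB : DefSet B) {R : K → K → Prop}
    (hR : DefPred fun w : Unit ⊕ Unit → K => R (w (Sum.inl ())) (w (Sum.inr ())))
    (hRA : ∀ x y, R x y → x ∈ A) (hRB : ∀ x y, R x y → y ∈ B)
    (huniq : ∀ x y y', R x y → R x y' → y = y') (htot : ∀ x ∈ A, ∃ y, R x y)
    (hsurj : ∀ y ∈ B, ∃ x, R x y) : D.dimIn B ≤ D.dimIn A := by
  simpa using D.dimIn_add_le hA hB hR hRA hRB huniq htot 0 fun y hy =>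
    D.dimIn_nonneg hK
      (hR.subst hK (f := Sum.elim (fun _ w => w ()) fun _ _ => y) (by
        rintro (_ | _)
        · exact defFun_proj hK ()
        · exact defFun_const hK y))
      (hsurj y hy)

end DimensionFunction

/-! ### Definable subfields of an interpretable field -/

namespace DimensionFunction

open FirstOrder ImaginarySort Set

variable {L : FirstOrder.Language.{u, v}} {T : L.Theory}
  {M : FirstOrder.Language.Theory.ModelType.{u, v, w} T} {n : ℕ} {S : ImaginarySort L M n}
  {K : Set S.Elem} [Field K]

theorem defSet_sup_span (hK : S.IsInterpretable K)
    (hadd : S.IsInterpretableOp fun x y : K => x + y)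
    (hmul : S.IsInterpretableOp fun x y : K => x * y) {C : Subfield K} (hC : DefSet (C : Set K))
    {V : Submodule C K} (hV : DefSet (V : Set K)) (a : K) :
    DefSet ((V ⊔ Submodule.span C {a} : Submodule C K) : Set K) := by
  have h : DefPred fun w : Unit → K => ∃ c, ∃ y, (y ∈ (V : Set K) ∧ c ∈ (C : Set K)) ∧
      y + c * a = w () :=
    DefPred.ex <| DefPred.ex <| ((hV.mem hK (defFun_proj hK _)).and
      (hC.mem hK (defFun_proj hK _))).and <| DefPred.eq hK
        (DefFun.op hK hadd (defFun_proj hK _)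
          (DefFun.op hK hmul (defFun_proj hK _) (defFun_const hK a))) (defFun_proj hK _)
  refine h.congr fun w => ?_
  simp only [SetLike.mem_coe, Submodule.mem_sup, Submodule.mem_span_singleton]
  constructor
  · rintro ⟨c, y, ⟨hy, hc⟩, h⟩
    exact ⟨y, hy, _, ⟨⟨c, hc⟩, rfl⟩, h⟩
  · rintro ⟨y, hy, _, ⟨c, rfl⟩, h⟩
    exact ⟨c, y, ⟨hy, c.2⟩, h⟩

theorem dimIn_add_le_sup_span (D : DimensionFunction.{u, v, w} T)
    (hK : S.IsInterpretable K)
    (hadd : S.IsInterpretableOp fun x y : K => x + y)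
    (hmul : S.IsInterpretableOp fun x y : K => x * y) {C : Subfield K} (hC : DefSet (C : Set K))
    {V : Submodule C K} (hV : DefSet (V : Set K)) {a : K} (ha : a ∉ V) {k : ℕ}
    (hk : k ≤ D.dimIn (V : Set K)) :
    D.dimIn (C : Set K) + k ≤ D.dimIn ((V ⊔ Submodule.span C {a} : Submodule C K) : Set K) := by
  have hR : DefPred fun w : Unit ⊕ Unit → K => w (Sum.inr ()) ∈ (C : Set K) ∧
      ∃ y, y ∈ (V : Set K) ∧ y + w (Sum.inr ()) * a = w (Sum.inl ()) :=
    (hC.mem hK (defFun_proj hK _)).and <| DefPred.ex <| (hV.mem hK (defFun_proj hK _)).and <|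
      DefPred.eq hK (DefFun.op hK hadd (defFun_proj hK _)
        (DefFun.op hK hmul (defFun_proj hK _) (defFun_const hK a))) (defFun_proj hK _)
  refine D.dimIn_add_le (defSet_sup_span hK hadd hmul hC hV a) hC
    (R := fun x c => c ∈ (C : Set K) ∧ ∃ y, y ∈ (V : Set K) ∧ y + c * a = x) hR ?_ ?_ ?_ ?_ k ?_
  · rintro x c ⟨hc, y, hy, rfl⟩
    exact Submodule.add_mem_sup hy (Submodule.mem_span_singleton.2 ⟨⟨c, hc⟩, rfl⟩)
  · exact fun x c h => h.1
  · rintro x c c' ⟨hc, y, hy, rfl⟩ ⟨hc', y', hy', h⟩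
    by_contra hne
    -- The coefficient of `a` is unique: otherwise a nonzero multiple of `a`, hence `a` itself,
    -- would lie in `V`.
    have hs : (⟨c, hc⟩ - ⟨c', hc'⟩ : C) • a ∈ V := by
      have : (⟨c, hc⟩ - ⟨c', hc'⟩ : C) • a = y' - y := by
        change (c - c') * a = y' - y
        linear_combination -h
      exact this ▸ V.sub_mem hy' hy
    refine ha ((V.smul_mem_iff ?_).1 hs)
    simpa [sub_eq_zero] using hne
  · intro x hx
    obtain ⟨y, hy, z, hz, rfl⟩ := Submodule.mem_sup.1 hx
    obtain ⟨c, rfl⟩ := Submodule.mem_span_singleton.1 hz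
    exact ⟨c, c.2, y, hy, rfl⟩
  · intro c hc
    -- The fibre over `c` is the translate `V + c * a`, which subtraction of `c * a` maps onto `V`.
    refine hk.trans (D.dimIn_le_of_surjOn hK ?_ hV
      (R := fun x y => y ∈ (V : Set K) ∧ y + c * a = x) ?_ ?_ ?_ ?_ ?_ ?_)
    · exact hR.subst hK (f := Sum.elim (fun _ w => w ()) fun _ _ => c) (by
        rintro (_ | _)
        · exact defFun_proj hK ()
        · exact defFun_const hK c)
    · exact (hV.mem hK (defFun_proj hK _)).and <| DefPred.eq hK
        (DefFun.op hK hadd (defFun_proj hK _) (defFun_const hK _)) (defFun_proj hK _)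
    · exact fun x y h => ⟨hc, y, h⟩
    · exact fun x y h => h.1
    · exact fun x y y' h h' => add_right_cancel (h.2.trans h'.2.symm)
    · exact fun x hx => hx.2
    · exact fun y hy => ⟨_, hy, rfl⟩

theorem finiteDimensional_of_infinite (D : DimensionFunction.{u, v, w} T)
    (hK : S.IsInterpretable K)
    (hadd : S.IsInterpretableOp fun x y : K => x + y)
    (hmul : S.IsInterpretableOp fun x y : K => x * y) {C : Subfield K} (hC : DefSet (C : Set K))
    (hinf : (C : Set K).Infinite) : FiniteDimensional C K := by
  by_contra hfin
  have h : ∀ m : ℕ, ∃ V : Submodule C K, V.FG ∧ DefSet (V : Set K) ∧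
      (m : WithBot ℕ) ≤ D.dimIn (V : Set K) := by
    intro m
    induction m with
    | zero =>
      refine ⟨⊥, Submodule.fg_bot, ?_, ?_⟩
      · exact DefPred.eq hK (defFun_proj hK ()) (defFun_const hK 0)
      · exact (D.dimIn_singleton hK 0).ge
    | succ m ih =>
      obtain ⟨V, hfg, hV, hm⟩ := ih
      obtain ⟨a, ha⟩ : ∃ a, a ∉ V := by
        by_contra! h
        exact hfin ⟨(eq_top_iff.2 fun x _ => h x : V = ⊤) ▸ hfg⟩
      refine ⟨V ⊔ Submodule.span C {a}, hfg.sup (Submodule.fg_span_singleton a),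
        defSet_sup_span hK hadd hmul hC hV a, ?_⟩
      refine le_trans ?_ (D.dimIn_add_le_sup_span hK hadd hmul hC hV ha hm)
      rw [Nat.cast_succ, add_comm]
      gcongr
      exact D.one_le_dimIn hK hC hinf
  have huniv : DefSet (univ : Set K) := (DefPred.true hK).congr fun w => by simp
  have h0 := D.dimIn_nonneg hK huniv univ_nonempty
  -- `K` is nonempty, so its dimension is a natural number `d`; a subspace of dimension at least `d
  -- + 1` is absurd.
  obtain ⟨d, hd⟩ := WithBot.ne_bot_iff_exists.1 (ne_bot_of_le_ne_bot WithBot.coe_ne_bot h0)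
  obtain ⟨V, -, hV, hle⟩ := h (d + 1)
  have := hle.trans ((D.dimIn_mono hV huniv (subset_univ _)).trans hd.ge)
  have : d + 1 ≤ d := WithBot.coe_le_coe.1 this
  omega

theorem defFun_pow (hK : S.IsInterpretable K)
    (hmul : S.IsInterpretableOp fun x y : K => x * y) (k : ℕ) :
    DefFun fun w : Unit → K => w () ^ k := by
  induction k with
  | zero => simpa using defFun_const hK 1
  | succ k ih => simpa only [pow_succ] using DefFun.op hK hmul ih (defFun_proj hK ())

theorem eq_top_of_range_frobenius_le (D : DimensionFunction.{u, v, w} T)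
    (hK : S.IsInterpretable K)
    (hadd : S.IsInterpretableOp fun x y : K => x + y)
    (hmul : S.IsInterpretableOp fun x y : K => x * y) {C : Subfield K} (hC : DefSet (C : Set K))
    (p : ℕ) [ExpChar K p] (hp : ∀ x : K, x ^ p ∈ C) : C = ⊤ := by
  have huniv : DefSet (univ : Set K) := (DefPred.true hK).congr fun w => by simp
  have h0 := D.dimIn_nonneg hK huniv univ_nonempty
  obtain ⟨d, hd⟩ := WithBot.ne_bot_iff_exists.1 (ne_bot_of_le_ne_bot WithBot.coe_ne_bot h0)
  by_contra hne
  obtain ⟨a, ha⟩ : ∃ a, a ∉ C := by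
    by_contra! h
    exact hne (eq_top_iff.2 fun x _ => h x)
  have hdim : D.dimIn (univ : Set K) ≤ D.dimIn (C : Set K) := by
    have hpow : DefPred fun w : Unit ⊕ Unit → K => w (Sum.inr ()) ^ p = w (Sum.inl ()) :=
      (defFun_pow hK hmul p).reindex hK Sum.swap
    have hrange : DefSet {x : K | ∃ y, y ^ p = x} := DefPred.ex hpow
    refine le_trans ?_ (D.dimIn_mono hrange hC ?_)
    -- The map is the `p`-th root, from the `p`-th powers onto `K`; it is single-valued because
    -- Frobenius is injective.
    · refine D.dimIn_le_of_surjOn hK hrange huniv (R := fun x y => y ^ p = x) hpow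
        (fun x y h => ⟨y, h⟩) (fun _ _ _ => mem_univ _) (fun x y y' h h' => ?_) (fun x h => h)
        fun y _ => ⟨_, rfl⟩
      exact frobenius_inj K p (h.trans h'.symm)
    · rintro x ⟨y, rfl⟩
      exact hp y
  -- `C` itself, as a `C`-subspace of `K`.
  let V : Submodule C K := 1
  have hVC : (V : Set K) = C := by
    ext x
    exact Submodule.mem_one.trans ⟨fun ⟨c, hc⟩ => hc ▸ c.2, fun hx => ⟨⟨x, hx⟩, rfl⟩⟩
  have hle : (d : WithBot ℕ) ≤ D.dimIn (V : Set K) := by rw [hVC]; exact hd.trans_le hdim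
  have h2 := D.dimIn_add_le_sup_span hK hadd hmul hC (hVC ▸ hC : DefSet (V : Set K))
    (a := a) (fun h => ha (by rw [← SetLike.mem_coe, hVC] at h; exact h)) hle
  have h3 := ((add_le_add_left (hd.trans_le hdim) _).trans h2).trans
    ((D.dimIn_mono (defSet_sup_span hK hadd hmul hC (hVC ▸ hC) a) huniv
      (subset_univ _)).trans hd.ge)
  have hd0 : d + d ≤ d := WithBot.coe_le_coe.1 h3
  obtain rfl : d = 0 := by omega
  have hfin : (univ : Set K).Finite :=
    ((D.dim_eq_zero_iff M S _ huniv.isInterpretable).1 hd.symm).2.of_finite_image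
      Subtype.val_injective.injOn
  have : Finite K := finite_univ_iff.1 hfin
  obtain ⟨b, rfl⟩ := Finite.surjective_of_injective (frobenius_inj K p) a
  exact ha (hp b)

end DimensionFunction

/-! ### Constants of a derivation and the conclusion -/

/-- The subfield of constants of a derivation of a field. -/
def Derivation.constants {F : Type*} [Field F] (δ : Derivation ℤ F F) : Subfield F where
  carrier := {x | δ x = 0}
  mul_mem' {x y} hx hy := by
    rw [Set.mem_ofPred] at *
    simp [hx, hy]
  one_mem' := δ.map_one_eq_zero
  add_mem' {x y} hx hy := by
    rw [Set.mem_ofPred] at *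
    simp [hx, hy]
  zero_mem' := δ.map_zero
  neg_mem' {x} hx := by
    rw [Set.mem_ofPred] at *
    simp [hx]
  inv_mem' x hx := by
    rw [Set.mem_ofPred] at *
    simp [Derivation.leibniz_inv, hx]

theorem Derivation.mem_constants {F : Type*} [Field F] {δ : Derivation ℤ F F} {x : F} :
    x ∈ δ.constants ↔ δ x = 0 := Iff.rfl

theorem Derivation.eq_zero_of_isAlgebraic_constants {F : Type*} [Field F] [CharZero F]
    (δ : Derivation ℤ F F) [Algebra.IsAlgebraic δ.constants F] : δ = 0 := by
  -- Linearity over the constants gives the chain rule `P'(x) * δ x = 0` for the minimal polynomial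
  -- `P` of `x`, and `P'(x) ≠ 0` by separability.
  let D : Derivation δ.constants F F :=
    { toFun := δ
      map_add' := δ.map_add
      map_smul' := fun c x => by
        have : δ (c : F) = 0 := c.2
        change δ (c * x) = c * δ x
        simp [this]
      map_one_eq_zero' := δ.map_one_eq_zero
      leibniz' := δ.leibniz }
  ext x
  have hx : IsIntegral δ.constants x := Algebra.IsIntegral.isIntegral x
  have h := D.map_aeval (minpoly δ.constants x) x
  rw [minpoly.aeval, map_zero, eq_comm, smul_eq_zero] at h
  exact h.resolve_left
    ((minpoly.irreducible hx).separable.aeval_derivative_ne_zero (minpoly.aeval _ x))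

theorem lemma2p6 {L : FirstOrder.Language.{u, v}} (T : L.Theory)
    (hT : FiniteDimensionalTheory.{u, v, w} T)
    (M : FirstOrder.Language.Theory.ModelType.{u, v, w} T)
    {n : ℕ} (S : ImaginarySort L M n) (K : Set S.Elem) (hK : S.IsInterpretable K)
    [Field K]
    (hadd : S.IsInterpretableOp fun x y : K => x + y)
    (hmul : S.IsInterpretableOp fun x y : K => x * y)
    (δ : Derivation ℤ K K) (hδ : S.IsInterpretableMap S (δ : K → K)) :
    δ = 0 := by
  obtain ⟨D⟩ := hT
  have hC : ImaginarySort.DefSet (δ.constants : Set K) :=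
    ImaginarySort.DefPred.eq hK
      (ImaginarySort.DefFun.map hK hδ (ImaginarySort.defFun_proj hK ()))
      (ImaginarySort.defFun_const hK 0)
  obtain ⟨p, hp⟩ := ExpChar.exists K
  cases hp with
  | zero =>
    have hinf : (δ.constants : Set K).Infinite :=
      Set.infinite_coe_iff.1 (inferInstanceAs (Infinite δ.constants))
    have := D.finiteDimensional_of_infinite hK hadd hmul hC hinf
    exact δ.eq_zero_of_isAlgebraic_constants
  | prime hp =>
    have : Fact p.Prime := ⟨hp⟩
    have htop : δ.constants = ⊤ := D.eq_top_of_range_frobenius_le hK hadd hmul hC p fun x => by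
      -- `δ (x ^ p)` carries the factor `p`, which is `0` in `K`.
      rw [Derivation.mem_constants, Derivation.leibniz_pow, ← Nat.cast_smul_eq_nsmul K]
      simp
    ext x
    have : x ∈ δ.constants := htop ▸ Subfield.mem_top x
    rw [Derivation.mem_constants.1 this, Derivation.zero_apply]
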